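/- Let $A$ be a finite totally ordered set, and let $\Gamma(A)$ be the set of columns on $A$, i.e. of subsets of $A$ (including $\emptyset$). For $x\in A$ and $\gamma\in\Gamma(A)$, let $x\cdot\gamma=(\gamma\setminus\{y\})\cup\{x\}$, where $y$ is the smallest element of $\gamma$ with $y\ge x$, if there is one, and $x\cdot\gamma=\gamma\cup\{x\}$ otherwise. This defines a left action of the free monoid $A^*$ on $\Gamma(A)$; the stylic monoid $\mathrm{Styl}(A)$ is the monoid of all endofunctions $\gamma\mapsto w\cdot\gamma$ of $\Gamma(A)$, $w\in A^*$, and $\mathbb Z\mathrm{Styl}(A)$ is its monoid algebra over $\mathbb Z$. Letters are identified with their images in $\mathbb Z\mathrm{Styl}(A)$. For $\gamma\in\Gamma(A)$ put $$e_\gamma=\prod_{a\notin\gamma}^{\nearrow}(1-a)\;\prod_{a\in\gamma}^{\searrow}a\in\mathbb Z\mathrm{Styl}(A),$$ where the first product is taken in increasing and the second in decreasing order of the letters. For $\gamma\in\Gamma(A)$ and $c\in A$, let $\gamma\cdot c=(\gamma\setminus\{b\})\cup\{c\}$, where $b$ is the largest element of $\gamma$ with $b\le c$, if there is one, and $\gamma\cdot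 c=\gamma\cup\{c\}$ otherwise; this right action is called frank if $\gamma$ has an element $\le c$ and $c\notin\gamma$. Let $Q(A)$ be the quiver with vertex set $\Gamma(A)$ and with an edge $\gamma\xrightarrow{c}\gamma'$ for every letter $c$ such that the right action of $c$ on $\gamma$ is frank and $\gamma\cdot c=\gamma'$. Let $\mathbb ZQ(A)$ be its path algebra: the free $\mathbb Z$-module on the paths of $Q(A)$, including an empty path at each vertex, where the product of two paths is their concatenation (first path first) if the first ends where the second starts, and $0$ otherwise. Let $\varphi:\mathbb ZQ(A)\to\mathbb Z\mathrm{Styl}(A)$ be the $\mathbb Z$-linear map that sends the empty path at $\gamma$ to $e_\gamma$ and a path $\gamma_0\xrightarrow{c_1}\gamma_1\xrightarrow{c_2}\cdots\xrightarrow{c_l}\gamma_l$ to $e_{\gamma_0}c_1e_{\gamma_1}c_2\cdots c_le_{\gamma_l}$. Then $\varphi$ is a homomorphism of (unital) $\mathbb Z$-algebras, and it is surjective. -/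

import Mathlib

noncomputable section

/-! ### The path algebra of a quiver -/

section PathAlgebra

/-- All paths of a quiver, of any length (empty paths included), with arbitrary endpoints. -/
structure QPath (V : Type*) [Quiver V] where
  /-- the starting vertex -/
  src : V
  /-- the final vertex -/
  tgt : V
  /-- the path itself -/
  path : Quiver.Path src tgt

/-- The path algebra `ℤQ`, as a `ℤ`-module: the free `ℤ`-module on the set of paths. -/
def PathAlgebra (V : Type*) [Quiver V] := QPath V →₀ ℤ

namespace PathAlgebra

variable {V : Type*} [Quiver V]

instance : AddCommGroup (PathAlgebra V) := inferInstanceAs (AddCommGroup (QPath V →₀ ℤ))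

/-- The basis element of the path algebra given by a path. -/
def ofPath (p : QPath V) : PathAlgebra V := Finsupp.single p (1 : ℤ)

open Classical in
/-- The natural product of two paths: their concatenation (first `p`, then `q`) if `p` ends where
`q` starts, and zero otherwise. -/
def pathMul (p q : QPath V) : PathAlgebra V :=
  if h : p.tgt = q.src then ofPath ⟨p.src, q.tgt, p.path.comp (q.path.cast h.symm rfl)⟩ else 0

/-- The `ℤ`-linear extension of a map defined on paths. -/
def extend {M : Type*} [AddCommGroup M] (f : QPath V → M) : PathAlgebra V →ₗ[ℤ] M :=
  Finsupp.linearCombination ℤ f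

theorem extend_ofPath {M : Type*} [AddCommGroup M] (f : QPath V → M) (p : QPath V) :
    extend f (ofPath p) = f p :=
  (Finsupp.linearCombination_single ℤ (1 : ℤ) p).trans (one_smul ℤ (f p))

/-- The multiplication: the bilinear extension of the product of paths. -/
def mulMap : PathAlgebra V →ₗ[ℤ] PathAlgebra V →ₗ[ℤ] PathAlgebra V :=
  extend fun p => extend fun q => pathMul p q

instance : Mul (PathAlgebra V) := ⟨fun x y => mulMap x y⟩

theorem mul_def (x y : PathAlgebra V) : x * y = mulMap x y := rfl

theorem ofPath_mul_ofPath (p q : QPath V) : ofPath p * ofPath q = pathMul p q := by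
  rw [mul_def, mulMap, extend_ofPath, extend_ofPath]

/-- The unit: the sum of all the empty paths. -/
instance [Fintype V] : One (PathAlgebra V) := ⟨∑ v : V, ofPath ⟨v, v, Quiver.Path.nil⟩⟩

theorem one_def [Fintype V] : (1 : PathAlgebra V) = ∑ v : V, ofPath ⟨v, v, Quiver.Path.nil⟩ := rfl

theorem pathMul_pos {u v w : V} (p : Quiver.Path u v) (q : Quiver.Path v w) :
    pathMul ⟨u, v, p⟩ ⟨v, w, q⟩ = ofPath ⟨u, w, p.comp q⟩ := by
  simp [pathMul]

theorem pathMul_neg {p q : QPath V} (h : p.tgt ≠ q.src) : pathMul p q = 0 := by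
  simp [pathMul, h]

theorem assoc_ofPath (p q r : QPath V) :
    ofPath p * ofPath q * ofPath r = ofPath p * (ofPath q * ofPath r) := by
  obtain ⟨p₁, p₂, p⟩ := p
  obtain ⟨q₁, q₂, q⟩ := q
  obtain ⟨r₁, r₂, r⟩ := r
  by_cases h : p₂ = q₁ <;> by_cases h' : q₂ = r₁
  · subst h; subst h'
    simp only [ofPath_mul_ofPath, pathMul_pos, Quiver.Path.comp_assoc]
  · subst h
    rw [ofPath_mul_ofPath, ofPath_mul_ofPath, pathMul_pos, ofPath_mul_ofPath,
      pathMul_neg (by simpa using h'), pathMul_neg (by simpa using h'), mul_def, map_zero]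
  · subst h'
    rw [ofPath_mul_ofPath, ofPath_mul_ofPath, pathMul_pos, ofPath_mul_ofPath,
      pathMul_neg (by simpa using h), pathMul_neg (by simpa using h), mul_def, map_zero,
      LinearMap.zero_apply]
  · rw [ofPath_mul_ofPath, ofPath_mul_ofPath, pathMul_neg (by simpa using h),
      pathMul_neg (by simpa using h'), mul_def, mul_def, map_zero, map_zero, LinearMap.zero_apply]

theorem induction_on' {P : PathAlgebra V → Prop} (x : PathAlgebra V) (h0 : P 0)
    (hadd : ∀ x y, P x → P y → P (x + y)) (hs : ∀ (n : ℤ) p, P (n • ofPath p)) : P x := by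
  refine Finsupp.induction_linear (motive := P) x h0 hadd fun p n => ?_
  have : (Finsupp.single p n : QPath V →₀ ℤ) = n • Finsupp.single p (1 : ℤ) := by simp
  rw [this]
  exact hs n p

theorem add_mul' (x y z : PathAlgebra V) : (x + y) * z = x * z + y * z := by
  simp [mul_def]

theorem mul_add' (x y z : PathAlgebra V) : x * (y + z) = x * y + x * z := by
  simp [mul_def]

theorem zero_mul' (x : PathAlgebra V) : 0 * x = 0 := by simp [mul_def]

theorem mul_zero' (x : PathAlgebra V) : x * 0 = 0 := by simp [mul_def]

theorem smul_mul' (n : ℤ) (x y : PathAlgebra V) : (n • x) * y = n • (x * y) := by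
  simp [mul_def]

theorem mul_smul' (n : ℤ) (x y : PathAlgebra V) : x * (n • y) = n • (x * y) := by
  simp [mul_def]

theorem mul_assoc' (x y z : PathAlgebra V) : x * y * z = x * (y * z) := by
  induction x using induction_on' with
  | h0 => simp only [zero_mul']
  | hadd a b ha hb => simp only [add_mul', ha, hb]
  | hs n p =>
    induction y using induction_on' with
    | h0 => simp only [zero_mul', mul_zero']
    | hadd a b ha hb => simp only [add_mul', mul_add', ha, hb]
    | hs m q =>
      induction z using induction_on' with
      | h0 => simp only [mul_zero']
      | hadd a b ha hb => simp only [mul_add', ha, hb]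
      | hs k r => simp only [smul_mul', mul_smul', assoc_ofPath]

theorem one_mul' [Fintype V] (x : PathAlgebra V) : 1 * x = x := by
  induction x using induction_on' with
  | h0 => exact mul_zero' _
  | hadd a b ha hb => rw [mul_add', ha, hb]
  | hs n p =>
    obtain ⟨u, v, p⟩ := p
    rw [mul_smul', one_def, mul_def, map_sum, LinearMap.sum_apply, Finset.sum_eq_single u]
    · rw [← mul_def, ofPath_mul_ofPath, pathMul_pos, Quiver.Path.nil_comp]
    · intro w _ hw
      rw [← mul_def, ofPath_mul_ofPath, pathMul_neg hw]
    · simp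

theorem mul_one' [Fintype V] (x : PathAlgebra V) : x * 1 = x := by
  induction x using induction_on' with
  | h0 => exact zero_mul' _
  | hadd a b ha hb => rw [add_mul', ha, hb]
  | hs n p =>
    obtain ⟨u, v, p⟩ := p
    rw [smul_mul', one_def, mul_def, map_sum, Finset.sum_eq_single v]
    · rw [← mul_def, ofPath_mul_ofPath, pathMul_pos, Quiver.Path.comp_nil]
    · intro w _ hw
      rw [← mul_def, ofPath_mul_ofPath, pathMul_neg hw.symm]
    · simp

/-- The path algebra of a quiver with finitely many vertices is a ring. -/
instance [Fintype V] : Ring (PathAlgebra V) :=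
  { (inferInstance : AddCommGroup (PathAlgebra V)) with
    mul := (· * ·)
    one := 1
    left_distrib := mul_add'
    right_distrib := add_mul'
    zero_mul := zero_mul'
    mul_zero := mul_zero'
    mul_assoc := mul_assoc'
    one_mul := one_mul'
    mul_one := mul_one' }

end PathAlgebra

end PathAlgebra

/-! ### Columns, the stylic monoid and its algebra

A column on `A` is a subset of `A`, so the set of columns is `Finset A`. -/

section Stylic

variable {A : Type*} [LinearOrder A]

/-- Column insertion of the letter `x` into the column `γ`: the smallest `y ∈ γ` with `x ≤ y`
is bumped if there is one. This is the left action `x · γ`. -/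
def columnInsert (x : A) (γ : Finset A) : Finset A :=
  if h : (γ.filter (x ≤ ·)).Nonempty then insert x (γ.erase ((γ.filter (x ≤ ·)).min' h))
  else insert x γ

/-- The left action of words on columns, as a monoid homomorphism into the endofunctions of the
set of columns (whose product is composition). -/
def stylicAction (A : Type*) [LinearOrder A] : FreeMonoid A →* Function.End (Finset A) :=
  FreeMonoid.lift (columnInsert : A → Function.End (Finset A))

/-- The stylic monoid: the monoid of endofunctions of the set of columns given by words. -/
abbrev Styl (A : Type*) [LinearOrder A] := MonoidHom.mrange (stylicAction A)

/-- The class of a word in the stylic monoid. -/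
def stylicClass (A : Type*) [LinearOrder A] : FreeMonoid A →* Styl A :=
  (stylicAction A).mrangeRestrict

/-- The stylic algebra over `ℤ`. -/
abbrev StylicAlgebra (A : Type*) [LinearOrder A] := MonoidAlgebra ℤ (Styl A)

/-- A letter, viewed in the stylic algebra. -/
def stylicLetter (a : A) : StylicAlgebra A :=
  MonoidAlgebra.of ℤ (Styl A) (stylicClass A (FreeMonoid.of a))

/-- The element `e_γ`: the product of the `1 - a`, for `a ∉ γ`, in increasing order, times the
product of the letters `a ∈ γ`, in decreasing order. -/
def stylicIdempotent [Fintype A] (γ : Finset A) : StylicAlgebra A :=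
  ((γᶜ.sort (· ≤ ·)).map fun a => 1 - stylicLetter a).prod *
    ((γ.sort (· ≥ ·)).map fun a => stylicLetter a).prod

/-! ### The quiver `Q(A)` -/

/-- The right action `γ · c` of a letter on a column: the largest `x ∈ γ` with `x ≤ c` is bumped
if there is one. -/
def rightInsert (γ : Finset A) (c : A) : Finset A :=
  if h : (γ.filter (· ≤ c)).Nonempty then insert c (γ.erase ((γ.filter (· ≤ c)).max' h))
  else insert c γ

/-- The right action of `c` on `γ` is frank if `min γ ≤ c` and `c ∉ γ`. -/
def IsFrank (γ : Finset A) (c : A) : Prop := (∃ x ∈ γ, x ≤ c) ∧ c ∉ γ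

/-- The vertices of the quiver `Q(A)`: the columns. (A synonym of `Finset A`, which keeps the
quiver apart from the one given by the inclusion order.) -/
def StylicQuiver (A : Type*) := Finset A

instance [Fintype A] : Fintype (StylicQuiver A) := inferInstanceAs (Fintype (Finset A))

/-- The edges `γ → γ'` of `Q(A)` are the letters `c` whose right action on `γ` is frank, with
`γ · c = γ'`. -/
instance : Quiver (StylicQuiver A) where
  Hom γ γ' := {c : A // IsFrank (A := A) γ c ∧ rightInsert (A := A) γ c = γ'}

/-- The element `e_{γ₀} c₁ e_{γ₁} c₂ ⋯ c_l e_{γ_l}` attached to the path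
`γ₀ → γ₁ → ⋯ → γ_l` with edges labelled `c₁, …, c_l`; it is `e_{γ₀}` if `l = 0`. -/
def pathImage [Fintype A] {γ : StylicQuiver A} :
    {δ : StylicQuiver A} → Quiver.Path γ δ → StylicAlgebra A
  | _, Quiver.Path.nil => stylicIdempotent (A := A) γ
  | δ, Quiver.Path.cons p c => pathImage p * stylicLetter c.1 * stylicIdempotent (A := A) δ

/-- The quiver map `φ : ℤQ(A) → ℤStyl(A)`, as a `ℤ`-linear map. -/
def quiverMap (A : Type*) [LinearOrder A] [Fintype A] :
    PathAlgebra (StylicQuiver A) →ₗ[ℤ] StylicAlgebra A :=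
  PathAlgebra.extend fun p => pathImage p.path

end Stylic

end

/-! Write `e_γ` as `ascProd γᶜ * columnWord γ`. Everything rests on two annihilation principles.

On the left, a letter fixes every column that contains it, so `1 - a` kills any combination of
monoid elements whose output columns all contain `a` (`covering`). Since inserting a letter never
removes a smaller one, an increasing product of factors `1 - a` dies as soon as one of its letters
is covered (`ascProd_mul_eq_zero`). On the right, the relations `bb = b` and `bab = ba` for `a < b`
give `columnWord γ * ascProd s = 0` when `γ` meets `s`.

Together they make the `e_γ` orthogonal idempotents (`stylicIdempotent_mul`); their sum is 1 by
telescoping on the largest letter. Hence the quiver map is a unital homomorphism.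

For surjectivity it suffices to reach each letter `a`, which is the sum of all `e_γ a e_δ`. If `a ∈
γ` then `e_γ a = e_γ`; if `a` is below all of `γ` then `e_γ a = 0`. In the frank case, with `b` the
bumped letter, `columnWord γ * a = b * columnWord (γ·a)`, and the annihilation argument leaves only
`δ = γ·a`, which is the image of an edge. -/

noncomputable section

variable {A : Type*} [LinearOrder A]

/-! ### Column insertion -/

/-- Eliminates the minimum: an old letter `z ≥ x` survives exactly when a smaller candidate is
bumped in its place. -/
theorem mem_columnInsert {x z : A} {C : Finset A} :
    z ∈ columnInsert x C ↔ z = x ∨ z ∈ C ∧ (x ≤ z → ∃ t ∈ C, x ≤ t ∧ t < z) := by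
  unfold columnInsert
  split_ifs with h
  · obtain ⟨m, hm⟩ : ∃ m, m = (C.filter (x ≤ ·)).min' h := ⟨_, rfl⟩
    have hle : ∀ t ∈ C, x ≤ t → m ≤ t := fun t ht hx =>
      hm ▸ Finset.min'_le _ _ (Finset.mem_filter.2 ⟨ht, hx⟩)
    have hmem : m ∈ C ∧ x ≤ m := Finset.mem_filter.1 (hm ▸ Finset.min'_mem _ h)
    rw [← hm, Finset.mem_insert, Finset.mem_erase]
    grind
  · simp only [Finset.Nonempty, Finset.mem_filter, Finset.mem_insert] at *
    grind

theorem columnInsert_of_mem {x : A} {C : Finset A} (h : x ∈ C) : columnInsert x C = C := by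
  ext z; rw [mem_columnInsert]; grind

/-- The letter `t` separates the two insertions: `x` bumps something at most `t`, while `y` affects
only letters above `t`. -/
theorem columnInsert_comm {x y : A} {C : Finset A} {t : A} (ht : t ∈ C) (hx : x ≤ t) (hy : t < y) :
    columnInsert y (columnInsert x C) = columnInsert x (columnInsert y C) := by
  ext z; simp only [mem_columnInsert]; grind

/-- With no letter of `C` in `[x, y)`, `y` bumps what `x` would have bumped, and `x` then bumps `y`.
-/
theorem columnInsert_absorb {x y : A} (h : x < y) {C : Finset A} (hC : ∀ t ∈ C, x ≤ t → y ≤ t) :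
    columnInsert x (columnInsert y C) = columnInsert x C := by
  ext z; simp only [mem_columnInsert]
  constructor
  · grind
  · rintro (h1 | ⟨h1, h2⟩)
    · exact Or.inl h1
    · right
      refine ⟨Or.inr ⟨h1, fun h3 => ?_⟩, fun h3 => ?_⟩
      · obtain ⟨t, h4, h5, h6⟩ := h2 (h.le.trans h3)
        exact ⟨t, h4, hC t h4 h5, h6⟩
      · exact ⟨y, Or.inl rfl, h.le, by grind⟩

theorem columnInsert_bab {a b : A} (h : a < b) (C : Finset A) :
    columnInsert b (columnInsert a (columnInsert b C)) = columnInsert b (columnInsert a C) := by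
  by_cases hC : ∃ t ∈ C, a ≤ t ∧ t < b
  · obtain ⟨t, ht, h1, h2⟩ := hC
    rw [columnInsert_comm ht h1 h2, columnInsert_of_mem]
    rw [← columnInsert_comm ht h1 h2, mem_columnInsert]; exact Or.inl rfl
  · rw [columnInsert_absorb h (by grind)]

theorem columnInsert_knuth {l b a : A} (hl : l < b) (h : b < a) (C : Finset A) :
    columnInsert b (columnInsert l (columnInsert a C)) =
      columnInsert b (columnInsert a (columnInsert l C)) := by
  by_cases hC : ∃ t ∈ C, l ≤ t ∧ t < a
  · obtain ⟨t, ht, h1, h2⟩ := hC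
    rw [columnInsert_comm ht h1 h2]
  · rw [columnInsert_absorb (hl.trans h) (by grind), columnInsert_absorb h]
    intro t ht hbt
    rw [mem_columnInsert] at ht
    grind

theorem columnInsert_self_mem (x : A) (C : Finset A) : x ∈ columnInsert x C :=
  mem_columnInsert.2 (Or.inl rfl)

theorem mem_columnInsert_of_lt {x z : A} {C : Finset A} (h : z < x) (hz : z ∈ C) :
    z ∈ columnInsert x C :=
  mem_columnInsert.2 (Or.inr ⟨hz, fun h' => absurd h h'.not_gt⟩)

/-! ### Words in the stylic algebra -/

theorem stylicClass_ofList_apply (L : List A) (C : Finset A) :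
    (stylicClass A (FreeMonoid.ofList L)).1 C = L.foldr columnInsert C := by
  induction L with
  | nil => rfl
  | cons a L ih =>
    rw [FreeMonoid.ofList_cons, map_mul, List.foldr_cons, ← ih]
    rfl

theorem prod_stylicLetter (L : List A) :
    (L.map stylicLetter).prod =
      MonoidAlgebra.of ℤ (Styl A) (stylicClass A (FreeMonoid.ofList L)) := by
  induction L with
  | nil => rw [FreeMonoid.ofList_nil, map_one, map_one, List.map_nil, List.prod_nil]
  | cons a L ih =>
    rw [FreeMonoid.ofList_cons, map_mul, map_mul, List.map_cons, List.prod_cons, ih]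
    rfl

theorem prod_stylicLetter_congr {L L' : List A}
    (h : ∀ C, L.foldr columnInsert C = L'.foldr columnInsert C) :
    (L.map stylicLetter).prod = (L'.map stylicLetter).prod := by
  rw [prod_stylicLetter, prod_stylicLetter]
  congr 1
  refine Subtype.ext (funext fun C => ?_)
  rw [stylicClass_ofList_apply, stylicClass_ofList_apply, h]

theorem stylicLetter_mul_self (a : A) : stylicLetter a * stylicLetter a = stylicLetter a := by
  simpa using prod_stylicLetter_congr (L := [a, a]) (L' := [a]) fun C =>
    columnInsert_of_mem (columnInsert_self_mem a C)

theorem stylicLetter_bab {a b : A} (h : a < b) :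
    stylicLetter b * stylicLetter a * stylicLetter b = stylicLetter b * stylicLetter a := by
  have := prod_stylicLetter_congr (L := [b, a, b]) (L' := [b, a]) fun C => by
    simp only [List.foldr_cons, List.foldr_nil, columnInsert_bab h]
  simpa only [List.map_cons, List.map_nil, List.prod_cons, List.prod_nil, mul_one, mul_assoc]
    using this

theorem stylicLetter_knuth {l b a : A} (hl : l < b) (h : b < a) :
    stylicLetter b * stylicLetter l * stylicLetter a =
      stylicLetter b * stylicLetter a * stylicLetter l := by
  have := prod_stylicLetter_congr (L := [b, l, a]) (L' := [b, a, l]) fun C => by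
    simp only [List.foldr_cons, List.foldr_nil, columnInsert_knuth hl h]
  simpa only [List.map_cons, List.map_nil, List.prod_cons, List.prod_nil, mul_one, mul_assoc]
    using this

/-! ### Elements all of whose columns contain given letters -/

/-- The span of the elements of the stylic monoid that send every column to a column
containing `S`. -/
def covering (S : Set A) : Submodule ℤ (StylicAlgebra A) :=
  Submodule.span ℤ (MonoidAlgebra.of ℤ (Styl A) '' {m | ∀ C, S ⊆ (m.1 C : Finset A)})

theorem covering_mono {S T : Set A} (h : T ⊆ S) : covering S ≤ covering T :=
  Submodule.span_mono (Set.image_mono fun _ hm C => h.trans (hm C))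

theorem stylicLetter_mul_mem_covering {S T : Set A} {a : A}
    (h : ∀ C : Finset A, S ⊆ C → T ⊆ columnInsert a C) {X : StylicAlgebra A}
    (hX : X ∈ covering S) : stylicLetter a * X ∈ covering T := by
  induction hX using Submodule.span_induction with
  | mem x hx =>
    obtain ⟨m, hm, rfl⟩ := hx
    rw [stylicLetter, ← map_mul]
    exact Submodule.subset_span ⟨_, fun C => h _ (hm C), rfl⟩
  | zero => simp
  | add x y _ _ hx hy => rw [mul_add]; exact add_mem hx hy
  | smul n x _ hx => rw [mul_smul_comm]; exact Submodule.smul_mem _ n hx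

/-- Inserting a letter already present changes nothing. -/
theorem stylicLetter_mul_of_mem_covering {S : Set A} {a : A} (ha : a ∈ S) {X : StylicAlgebra A}
    (hX : X ∈ covering S) : stylicLetter a * X = X := by
  induction hX using Submodule.span_induction with
  | mem x hx =>
    obtain ⟨m, hm, rfl⟩ := hx
    rw [stylicLetter, ← map_mul]
    congr 1
    exact Subtype.ext (funext fun C => columnInsert_of_mem (hm C ha))
  | zero => simp
  | add x y _ _ hx hy => rw [mul_add, hx, hy]
  | smul n x _ hx => rw [mul_smul_comm, hx]

theorem one_mem_covering_empty : (1 : StylicAlgebra A) ∈ covering (∅ : Set A) :=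
  Submodule.subset_span ⟨1, fun _ => Set.empty_subset _, rfl⟩

/-- The letters of `D` act smallest first. One that is at most `y` is already present and acts
trivially; a new one exceeds `y` and all letters of `D` inserted before it, so it bumps none of
them. -/
theorem prod_stylicLetter_mul_mem_covering {D : List A} (hD : D.Pairwise (· > ·)) {S : Set A}
    {y : A} (hy : y ∈ S) (hS : ∀ d ∈ D, d < y → d ∈ S) {Y : StylicAlgebra A}
    (hY : Y ∈ covering S) :
    (D.map stylicLetter).prod * Y ∈ covering ({x ∈ S | x ≤ y} ∪ {x | x ∈ D}) := by
  induction D with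
  | nil => simpa using covering_mono (Set.sep_subset S _) hY
  | cons d D ih =>
    rw [List.pairwise_cons] at hD
    rw [List.map_cons, List.prod_cons, mul_assoc]
    refine stylicLetter_mul_mem_covering (fun C hC => ?_)
      (ih hD.2 fun e he => hS e (List.mem_cons_of_mem _ he))
    by_cases hd : d ∈ C
    · rw [columnInsert_of_mem hd]
      rintro z (hz | hz)
      · exact hC (Or.inl hz)
      · rcases List.mem_cons.1 hz with rfl | hz
        exacts [hd, hC (Or.inr hz)]
    · have hyd : y < d := by
        by_contra hn
        refine hd (hC (Or.inl ⟨?_, not_lt.1 hn⟩))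
        rcases (not_lt.1 hn).lt_or_eq with h | rfl
        exacts [hS d List.mem_cons_self h, hy]
      rintro z (hz | hz)
      · exact mem_columnInsert_of_lt (hz.2.trans_lt hyd) (hC (Or.inl hz))
      · rcases List.mem_cons.1 hz with rfl | hz
        exacts [columnInsert_self_mem _ _, mem_columnInsert_of_lt (hD.1 _ hz) (hC (Or.inr hz))]

theorem prod_stylicLetter_mem_covering {D : List A} (hD : D.Pairwise (· > ·)) :
    (D.map stylicLetter).prod ∈ covering {x | x ∈ D} := by
  induction D with
  | nil => simpa using one_mem_covering_empty
  | cons d D ih =>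
    rw [List.pairwise_cons] at hD
    rw [List.map_cons, List.prod_cons]
    refine stylicLetter_mul_mem_covering (fun C hC z hz => ?_) (ih hD.2)
    rcases List.mem_cons.1 hz with rfl | hz
    exacts [columnInsert_self_mem _ _, mem_columnInsert_of_lt (hD.1 _ hz) (hC hz)]

theorem prod_stylicLetter_mul_of_mem_covering {D : List A} {S : Set A} (hD : ∀ d ∈ D, d ∈ S)
    {X : StylicAlgebra A} (hX : X ∈ covering S) : (D.map stylicLetter).prod * X = X := by
  induction D with
  | nil => simp
  | cons d D ih =>
    rw [List.map_cons, List.prod_cons, mul_assoc, ih fun e he => hD e (List.mem_cons_of_mem _ he),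
      stylicLetter_mul_of_mem_covering (hD d List.mem_cons_self) hX]

theorem prod_one_sub_mul_mem_covering {l : List A} {y : A} (hl : ∀ x ∈ l, y < x) {S : Set A}
    {X : StylicAlgebra A} (hX : X ∈ covering S) :
    (l.map fun a => 1 - stylicLetter a).prod * X ∈ covering {x ∈ S | x ≤ y} := by
  induction l with
  | nil => simpa using covering_mono (Set.sep_subset S _) hX
  | cons a l ih =>
    have h := ih fun x hx => hl x (List.mem_cons_of_mem _ hx)
    rw [List.map_cons, List.prod_cons, mul_assoc, sub_mul, one_mul]
    exact sub_mem h (stylicLetter_mul_mem_covering (fun C hC z hz =>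
      mem_columnInsert_of_lt (hz.2.trans_lt (hl a List.mem_cons_self)) (hC hz)) h)

/-- The factors to the right of `1 - z` involve only letters above `z`, so `z` is still covered when
`1 - z` acts. -/
theorem prod_one_sub_mul_eq_zero {l : List A} (hl : l.Pairwise (· < ·)) {S : Set A} {z : A}
    (hz : z ∈ l) (hS : z ∈ S) {X : StylicAlgebra A} (hX : X ∈ covering S) :
    (l.map fun a => 1 - stylicLetter a).prod * X = 0 := by
  induction l with
  | nil => simp at hz
  | cons a l ih =>
    rw [List.pairwise_cons] at hl
    rw [List.map_cons, List.prod_cons, mul_assoc]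
    rcases List.mem_cons.1 hz with rfl | hz
    · rw [sub_mul, one_mul, stylicLetter_mul_of_mem_covering (S := {x ∈ S | x ≤ z}) ⟨hS, le_rfl⟩
        (prod_one_sub_mul_mem_covering hl.1 hX), sub_self]
    · rw [ih hl.2 hz, mul_zero]

/-- The factors `1 - y` can be erased one by one from the left: the term containing `y` covers both
`y` and `D`, hence is killed by `T`. -/
theorem mul_prod_one_sub_mul_eq {D l : List A} (hD : D.Pairwise (· > ·)) (hl : l.Pairwise (· < ·))
    {S : Set A} (hDS : ∀ d ∈ D, d ∈ S) {T X : StylicAlgebra A} (hX : X ∈ covering S)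
    (hT : ∀ y ∈ l, ∀ Y ∈ covering (insert y {x | x ∈ D}), T * Y = 0) :
    T * ((D.map stylicLetter).prod * ((l.map fun a => 1 - stylicLetter a).prod * X)) =
      T * ((D.map stylicLetter).prod * X) := by
  induction l with
  | nil => simp
  | cons y l ih =>
    rw [List.pairwise_cons] at hl
    rw [List.map_cons, List.prod_cons, mul_assoc (1 - stylicLetter y), sub_mul, one_mul, mul_sub,
      mul_sub, ih hl.2 fun z hz => hT z (List.mem_cons_of_mem _ hz), sub_eq_self]
    refine hT y List.mem_cons_self _ ?_
    -- The remaining factors have letters above `y`, so the part of `S` below `y` survives, and `y`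
    -- itself is then inserted.
    have h1 : stylicLetter y * ((l.map fun a => 1 - stylicLetter a).prod * X) ∈
        covering (insert y {x ∈ S | x < y}) := by
      refine stylicLetter_mul_mem_covering (S := {x ∈ S | x ≤ y}) (fun C hC z hz => ?_)
        (prod_one_sub_mul_mem_covering hl.1 hX)
      rcases hz with rfl | hz
      exacts [columnInsert_self_mem _ _, mem_columnInsert_of_lt hz.2 (hC ⟨hz.1, hz.2.le⟩)]
    refine covering_mono ?_ (prod_stylicLetter_mul_mem_covering hD
      (S := insert y {x ∈ S | x < y}) (Set.mem_insert y _) (fun d hd hdy => Or.inr ⟨hDS d hd, hdy⟩) h1)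
    rintro z (rfl | hz)
    exacts [Or.inl ⟨Or.inl rfl, le_rfl⟩, Or.inr hz]

/-! ### Absorption on the right -/

theorem mul_prod_mul_self {R : Type*} [Monoid R] {b : R} (hb : b * b = b) {L : List R}
    (h : ∀ x ∈ L, b * x * b = b * x) : b * L.prod * b = b * L.prod := by
  induction L with
  | nil => simpa using hb
  | cons x L ih =>
    have ih := ih fun y hy => h y (List.mem_cons_of_mem _ hy)
    have hx := h x List.mem_cons_self
    rw [List.prod_cons]
    calc b * (x * L.prod) * b = b * x * b * L.prod * b := by rw [hx]; simp only [mul_assoc]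
      _ = b * x * (b * L.prod * b) := by simp only [mul_assoc]
      _ = b * x * b * L.prod := by rw [ih]; simp only [mul_assoc]
      _ = b * (x * L.prod) := by rw [hx, mul_assoc]

/-- The factors before `1 - b` involve letters below `b`; by `bab = ba`, a copy of `b` can be
carried through them to meet `1 - b`. -/
theorem stylicLetter_mul_prod_one_sub {l : List A} (hl : l.Pairwise (· < ·)) {b : A} (hb : b ∈ l) :
    stylicLetter b * (l.map fun a => 1 - stylicLetter a).prod = 0 := by
  obtain ⟨s, t, rfl⟩ := List.append_of_mem hb
  have h : stylicLetter b * (s.map fun a => 1 - stylicLetter a).prod * stylicLetter b =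
      stylicLetter b * (s.map fun a => 1 - stylicLetter a).prod := by
    refine mul_prod_mul_self (stylicLetter_mul_self b) fun x hx => ?_
    obtain ⟨a, ha, rfl⟩ := List.mem_map.1 hx
    rw [mul_sub, mul_one, sub_mul, stylicLetter_mul_self,
      stylicLetter_bab ((List.pairwise_append.1 hl).2.2 a ha b List.mem_cons_self)]
  rw [List.map_append, List.prod_append, List.map_cons, List.prod_cons, ← mul_assoc, ← mul_assoc,
    mul_sub, mul_one, h, sub_self, zero_mul]

theorem prod_stylicLetter_mul_stylicLetter {D : List A} (hD : D.Pairwise (· > ·)) {b : A}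
    (hb : b ∈ D) : (D.map stylicLetter).prod * stylicLetter b = (D.map stylicLetter).prod := by
  obtain ⟨s, t, rfl⟩ := List.append_of_mem hb
  have h : stylicLetter b * (t.map stylicLetter).prod * stylicLetter b =
      stylicLetter b * (t.map stylicLetter).prod := by
    refine mul_prod_mul_self (stylicLetter_mul_self b) fun x hx => ?_
    obtain ⟨a, ha, rfl⟩ := List.mem_map.1 hx
    exact stylicLetter_bab ((List.pairwise_cons.1 (List.pairwise_append.1 hD).2.1).1 a ha)
  rw [List.map_append, List.prod_append, List.map_cons, List.prod_cons, mul_assoc, h]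

/-! ### Frank insertion -/

/-- No letter of `H` bumps the smaller `a`, which therefore stays as the separator needed in
`columnInsert_comm`. -/
theorem foldr_columnInsert_comm {H : List A} {b a : A} (hba : b ≤ a) (hH : ∀ h ∈ H, a < h)
    {C : Finset A} (ha : a ∈ C) :
    a ∈ H.foldr columnInsert C ∧
      H.foldr columnInsert (columnInsert b C) = columnInsert b (H.foldr columnInsert C) := by
  induction H with
  | nil => exact ⟨ha, rfl⟩
  | cons h H ih =>
    obtain ⟨h1, h2⟩ := ih fun x hx => hH x (List.mem_cons_of_mem _ hx)
    have hh := hH h List.mem_cons_self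
    exact ⟨mem_columnInsert_of_lt hh h1, by
      rw [List.foldr_cons, List.foldr_cons, h2, columnInsert_comm h1 hba hh]⟩

theorem prod_stylicLetter_append_mul {H : List A} {b a : A} (hba : b ≤ a) (hH : ∀ h ∈ H, a < h) :
    (H.map stylicLetter).prod * (stylicLetter b * stylicLetter a) =
      stylicLetter b * ((H.map stylicLetter).prod * stylicLetter a) := by
  simpa using prod_stylicLetter_congr (L := H ++ [b, a]) (L' := b :: (H ++ [a])) fun C => by
    simpa using (foldr_columnInsert_comm hba hH (columnInsert_self_mem a C)).2

theorem stylicLetter_mul_prod_mul {l : List A} {b a : A} (hba : b < a) (hl : ∀ x ∈ l, x < b)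
    (hd : l.Pairwise (· > ·)) :
    stylicLetter b * (l.map stylicLetter).prod * stylicLetter a =
      stylicLetter b * stylicLetter a * (l.map stylicLetter).prod := by
  induction l generalizing b with
  | nil => simp
  | cons x l ih =>
    rw [List.pairwise_cons] at hd
    have hx := hl x List.mem_cons_self
    rw [List.map_cons, List.prod_cons]
    calc stylicLetter b * (stylicLetter x * (l.map stylicLetter).prod) * stylicLetter a
        = stylicLetter b * (stylicLetter x * (l.map stylicLetter).prod * stylicLetter a) := by
          simp only [mul_assoc]
      _ = stylicLetter b * stylicLetter x * stylicLetter a * (l.map stylicLetter).prod := by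
          rw [ih (hx.trans hba) hd.1 hd.2]; simp only [mul_assoc]
      _ = _ := by rw [stylicLetter_knuth hx hba]; simp only [mul_assoc]

/-- Knuth relations move `a` left through `l`; once `a` sits right after `b`, `b` commutes with the
larger letters `H`. -/
theorem prod_stylicLetter_frank {H l : List A} {b a : A} (hba : b < a) (hH : ∀ h ∈ H, a < h)
    (hl : ∀ x ∈ l, x < b) (hd : l.Pairwise (· > ·)) :
    ((H ++ b :: l).map stylicLetter).prod * stylicLetter a =
      stylicLetter b * ((H ++ a :: l).map stylicLetter).prod := by
  simp only [List.map_append, List.prod_append, List.map_cons, List.prod_cons]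
  rw [mul_assoc, stylicLetter_mul_prod_mul hba hl hd, ← mul_assoc,
    prod_stylicLetter_append_mul hba.le hH]
  simp only [mul_assoc]

theorem sort_ge_pairwise_gt (γ : Finset A) : (γ.sort (· ≥ ·)).Pairwise (· > ·) :=
  γ.sortedGT_sort.pairwise

theorem sort_le_pairwise_lt (γ : Finset A) : (γ.sort (· ≤ ·)).Pairwise (· < ·) :=
  γ.sortedLT_sort.pairwise

theorem sort_ge_eq_of_pairwise {γ : Finset A} {L : List A} (hL : L.Pairwise (· > ·))
    (h : ∀ x, x ∈ L ↔ x ∈ γ) : γ.sort (· ≥ ·) = L := by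
  have : γ = L.toFinset := by ext x; simp [h]
  rw [this]
  exact (List.toFinset_sort (· ≥ ·) (hL.imp fun h => ne_of_gt h)).2 (hL.imp fun h => le_of_lt h)

theorem sort_le_eq_of_pairwise {γ : Finset A} {L : List A} (hL : L.Pairwise (· < ·))
    (h : ∀ x, x ∈ L ↔ x ∈ γ) : γ.sort (· ≤ ·) = L := by
  have : γ = L.toFinset := by ext x; simp [h]
  rw [this]
  exact (List.toFinset_sort (· ≤ ·) (hL.imp fun h => ne_of_lt h)).2 (hL.imp fun h => le_of_lt h)

theorem sort_ge_insert_between {H l : Finset A} {b : A} (hH : ∀ h ∈ H, b < h)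
    (hl : ∀ x ∈ l, x < b) :
    (H ∪ insert b l).sort (· ≥ ·) = H.sort (· ≥ ·) ++ b :: l.sort (· ≥ ·) := by
  refine sort_ge_eq_of_pairwise ?_ fun x => by simp [or_left_comm]
  rw [List.pairwise_append, List.pairwise_cons]
  refine ⟨sort_ge_pairwise_gt H, ⟨fun x hx => hl x (by simpa using hx), sort_ge_pairwise_gt l⟩,
    fun x hx y hy => ?_⟩
  have hx := hH x (by simpa using hx)
  rcases List.mem_cons.1 hy with rfl | hy
  exacts [hx, (hl y (by simpa using hy)).trans hx]

/-! ### The two factors of `e_γ` -/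

/-- The decreasing product of the letters of `γ`. -/
def columnWord (γ : Finset A) : StylicAlgebra A :=
  ((γ.sort (· ≥ ·)).map fun a => stylicLetter a).prod

/-- The increasing product of the `1 - a`, for `a ∈ s`. -/
def ascProd (s : Finset A) : StylicAlgebra A :=
  ((s.sort (· ≤ ·)).map fun a => 1 - stylicLetter a).prod

theorem stylicIdempotent_eq [Fintype A] (γ : Finset A) :
    stylicIdempotent γ = ascProd γᶜ * columnWord γ := rfl

theorem columnWord_mem_covering (γ : Finset A) : columnWord γ ∈ covering (γ : Set A) := by
  simpa [columnWord] using prod_stylicLetter_mem_covering (sort_ge_pairwise_gt γ)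

theorem columnWord_mul_columnWord {γ δ : Finset A} (h : γ ⊆ δ) :
    columnWord γ * columnWord δ = columnWord δ :=
  prod_stylicLetter_mul_of_mem_covering (S := (δ : Set A)) (fun d hd => h (by simpa using hd))
    (columnWord_mem_covering δ)

theorem columnWord_mul_stylicLetter {γ : Finset A} {b : A} (hb : b ∈ γ) :
    columnWord γ * stylicLetter b = columnWord γ :=
  prod_stylicLetter_mul_stylicLetter (sort_ge_pairwise_gt γ) (by simpa using hb)

theorem columnWord_mul_ascProd {γ s : Finset A} {b : A} (hb : b ∈ γ) (hs : b ∈ s) :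
    columnWord γ * ascProd s = 0 := by
  rw [← columnWord_mul_stylicLetter hb, mul_assoc, ascProd,
    stylicLetter_mul_prod_one_sub (sort_le_pairwise_lt s) (by simpa using hs), mul_zero]

theorem ascProd_mul_eq_zero {s : Finset A} {S : Set A} {z : A} (hz : z ∈ s) (hS : z ∈ S)
    {X : StylicAlgebra A} (hX : X ∈ covering S) : ascProd s * X = 0 :=
  prod_one_sub_mul_eq_zero (sort_le_pairwise_lt s) (by simpa using hz) hS hX

/-- Applied with `T = ascProd γᶜ` for orthogonality, and with `T = ascProd γᶜ * b` and `γ·a` in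
place of `γ` for a frank action. -/
theorem mul_columnWord_mul_stylicIdempotent [Fintype A] {γ δ : Finset A} (h : γ ⊆ δ)
    {T : StylicAlgebra A}
    (hT : ∀ y ∉ δ, ∀ Y ∈ covering (insert y (γ : Set A)), T * Y = 0) :
    T * (columnWord γ * stylicIdempotent δ) = T * columnWord δ := by
  refine (mul_prod_one_sub_mul_eq (sort_ge_pairwise_gt γ) (sort_le_pairwise_lt δᶜ)
    (fun d hd => h (by simpa using hd)) (columnWord_mem_covering δ) fun y hy Y hY =>
      hT y (by simpa using hy) Y (by simpa using hY)).trans ?_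
  exact congrArg (T * ·) (columnWord_mul_columnWord h)

theorem columnWord_mul_stylicIdempotent_eq_zero [Fintype A] {γ δ : Finset A} (h : ¬γ ⊆ δ) :
    columnWord γ * stylicIdempotent δ = 0 := by
  obtain ⟨b, hb, hδ⟩ := Finset.not_subset.1 h
  rw [stylicIdempotent_eq, ← mul_assoc, columnWord_mul_ascProd hb (Finset.mem_compl.2 hδ), zero_mul]

/-! ### Orthogonality -/

theorem stylicIdempotent_mul [Fintype A] (γ δ : Finset A) :
    stylicIdempotent γ * stylicIdempotent δ = if γ = δ then stylicIdempotent γ else 0 := by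
  rw [stylicIdempotent_eq γ, mul_assoc]
  by_cases h : γ ⊆ δ
  · rw [mul_columnWord_mul_stylicIdempotent h fun y hy Y hY =>
      ascProd_mul_eq_zero (Finset.mem_compl.2 fun hγ => hy (h hγ)) (Set.mem_insert y _) hY]
    split_ifs with h'
    · rw [h']
    · obtain ⟨x, hx, hxγ⟩ := Finset.not_subset.1 fun h'' => h' (h.antisymm h'')
      exact ascProd_mul_eq_zero (Finset.mem_compl.2 hxγ) hx (columnWord_mem_covering δ)
  · rw [columnWord_mul_stylicIdempotent_eq_zero h, mul_zero, if_neg fun h' => h h'.subset]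

/-- A maximal letter `m` comes last in the increasing product and first in the decreasing one, so
`γ` and `γ ∪ {m}` together contribute `(1 - m) + m = 1` in the middle. -/
theorem sum_ascProd_mul_columnWord (s : Finset A) :
    ∑ γ ∈ s.powerset, ascProd (s \ γ) * columnWord γ = 1 := by
  induction s using Finset.induction_on_max with
  | empty => simp [ascProd, columnWord]
  | insert m s hm ih =>
    have hms : m ∉ s := fun h => lt_irrefl m (hm m h)
    rw [Finset.sum_powerset_insert hms, ← Finset.sum_add_distrib, ← ih]
    refine Finset.sum_congr rfl fun γ hγ => ?_
    rw [Finset.mem_powerset] at hγ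
    have hmγ : m ∉ γ := fun h => hms (hγ h)
    have h1 : ascProd (insert m s \ γ) = ascProd (s \ γ) * (1 - stylicLetter m) := by
      rw [ascProd, sort_le_eq_of_pairwise (L := (s \ γ).sort (· ≤ ·) ++ [m])]
      · simp [ascProd]
      · rw [List.pairwise_append]
        refine ⟨sort_le_pairwise_lt _, List.pairwise_singleton _ _, fun x hx y hy => ?_⟩
        rw [List.mem_singleton.1 hy]
        exact hm x (Finset.mem_sdiff.1 (by simpa using hx)).1
      · intro x
        simp only [List.mem_append, Finset.mem_sort, Finset.mem_sdiff, List.mem_singleton,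
          Finset.mem_insert]
        grind
    have h2 : insert m s \ insert m γ = s \ γ := by
      ext x; simp only [Finset.mem_sdiff, Finset.mem_insert]; grind
    have h3 : columnWord (insert m γ) = stylicLetter m * columnWord γ := by
      rw [columnWord, Finset.sort_insert (· ≥ ·) (fun b hb => (hm b (hγ hb)).le) hmγ, List.map_cons,
        List.prod_cons, columnWord]
    rw [h1, h2, h3, mul_assoc, ← mul_add, sub_mul, one_mul, sub_add_cancel]

theorem sum_stylicIdempotent [Fintype A] : ∑ γ : Finset A, stylicIdempotent γ = 1 := by
  rw [← sum_ascProd_mul_columnWord (Finset.univ : Finset A), Finset.powerset_univ]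
  rfl

/-! ### Products `e_γ a e_δ` -/

theorem columnWord_mul_stylicLetter_frank {γ : Finset A} {b a : A} (hb : b ∈ γ) (hba : b < a)
    (h : ∀ x ∈ γ, x ≤ b ∨ a < x) :
    columnWord γ * stylicLetter a = stylicLetter b * columnWord (insert a (γ.erase b)) := by
  have h1 : γ = γ.filter (a < ·) ∪ insert b (γ.filter (· < b)) := by
    ext x; simp only [Finset.mem_union, Finset.mem_filter, Finset.mem_insert]; grind
  have h2 : insert a (γ.erase b) = γ.filter (a < ·) ∪ insert a (γ.filter (· < b)) := by
    ext x; simp only [Finset.mem_union, Finset.mem_filter, Finset.mem_insert, Finset.mem_erase]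
    grind
  have hH : ∀ x ∈ γ.filter (a < ·), a < x := fun x hx => (Finset.mem_filter.1 hx).2
  have hl : ∀ x ∈ γ.filter (· < b), x < b := fun x hx => (Finset.mem_filter.1 hx).2
  have e1 := sort_ge_insert_between (fun x hx => hba.trans (hH x hx)) hl
  have e2 := sort_ge_insert_between hH fun x hx => (hl x hx).trans hba
  rw [← h1] at e1
  rw [← h2] at e2
  rw [columnWord, columnWord, e1, e2]
  exact prod_stylicLetter_frank hba (fun x hx => hH x (by simpa using hx))
    (fun x hx => hl x (by simpa using hx)) (sort_ge_pairwise_gt _)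

theorem stylicIdempotent_mul_stylicLetter_of_mem [Fintype A] {γ : Finset A} {a : A} (h : a ∈ γ) :
    stylicIdempotent γ * stylicLetter a = stylicIdempotent γ := by
  rw [stylicIdempotent_eq, mul_assoc, columnWord_mul_stylicLetter h]

theorem stylicIdempotent_mul_stylicLetter_of_lt [Fintype A] {γ : Finset A} {a : A}
    (h : ∀ x ∈ γ, a < x) : stylicIdempotent γ * stylicLetter a = 0 := by
  have h1 : columnWord γ * stylicLetter a = columnWord (insert a γ) := by
    have := sort_ge_insert_between (l := ∅) h (by simp)
    rw [columnWord, columnWord, Finset.insert_eq, Finset.union_comm, ← insert_empty_eq, this]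
    simp
  rw [stylicIdempotent_eq, mul_assoc, h1]
  exact ascProd_mul_eq_zero (Finset.mem_compl.2 fun ha => lt_irrefl a (h a ha))
    (Finset.mem_insert_self a γ) (columnWord_mem_covering _)

/-- After inserting `b`, some letter of `s` is still covered. If `b ≤ y < a`, the bumped letter is
at most `y`, so `a` survives. Otherwise `y` survives, being below `b` or above the candidate `a`,
and `y ∉ γ`. -/
theorem ascProd_mul_stylicLetter_mul_eq_zero {γ s : Finset A} {b a : A} (has : a ∈ s) (hba : b < a)
    (hs : ∀ x ∉ γ, x ∈ s) {y : A} (hya : y ≠ a)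
    (hy : y ∈ γ → y = b) {Y : StylicAlgebra A}
    (hY : Y ∈ covering (insert y (insert a (γ.erase b) : Finset A) : Set A)) :
    ascProd s * (stylicLetter b * Y) = 0 := by
  by_cases hyb : b ≤ y ∧ y < a
  · refine ascProd_mul_eq_zero has (Set.mem_singleton a)
      (stylicLetter_mul_mem_covering (fun C hC => ?_) hY)
    refine Set.singleton_subset_iff.2 (mem_columnInsert.2 (Or.inr ⟨hC (by simp), fun _ =>
      ⟨y, hC (Set.mem_insert y _), hyb.1, hyb.2⟩⟩))
  · refine ascProd_mul_eq_zero (z := y) (hs y fun hyγ => hyb ?_) (Set.mem_singleton y)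
      (stylicLetter_mul_mem_covering (fun C hC => ?_) hY)
    · rw [hy hyγ]; exact ⟨le_rfl, hba⟩
    · refine Set.singleton_subset_iff.2 (mem_columnInsert.2 (Or.inr ⟨hC (Set.mem_insert y _),
        fun hle => ⟨a, hC (by simp), hba.le, ?_⟩⟩))
      exact lt_of_le_of_ne (not_lt.1 fun hlt => hyb ⟨hle, hlt⟩) hya.symm

theorem stylicIdempotent_mul_stylicLetter_mul_eq_zero [Fintype A] {γ δ : Finset A} {b a : A}
    (hb : b ∈ γ) (hba : b < a) (h : ∀ x ∈ γ, x ≤ b ∨ a < x) (hδ : insert a (γ.erase b) ≠ δ) :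
    stylicIdempotent γ * stylicLetter a * stylicIdempotent δ = 0 := by
  have haγ : a ∉ γ := fun ha => by
    rcases h a ha with h' | h'
    exacts [h'.not_gt hba, lt_irrefl a h']
  rw [stylicIdempotent_eq γ, mul_assoc (ascProd _), columnWord_mul_stylicLetter_frank hb hba h]
  by_cases hsub : insert a (γ.erase b) ⊆ δ
  · have key : ∀ y ∉ insert a (γ.erase b), ∀ Y ∈ covering
        (insert y (insert a (γ.erase b) : Finset A) : Set A),
        ascProd γᶜ * stylicLetter b * Y = 0 := fun y hy Y hY => by
      rw [mul_assoc]
      refine ascProd_mul_stylicLetter_mul_eq_zero (Finset.mem_compl.2 haγ) hba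
        (fun x hx => Finset.mem_compl.2 hx) (fun e => hy (by simp [e])) (fun hyγ => ?_) hY
      by_contra hne
      exact hy (Finset.mem_insert_of_mem (Finset.mem_erase.2 ⟨hne, hyγ⟩))
    rw [← mul_assoc, mul_assoc, mul_columnWord_mul_stylicIdempotent hsub fun y hy Y hY =>
      key y (fun h' => hy (hsub h')) Y hY]
    -- Since `δ` strictly contains `γ·a`, its word covers an extra letter `x`, and `key` applies
    -- once more.
    obtain ⟨x, hx, hxγ⟩ := Finset.not_subset.1 fun h'' => hδ (hsub.antisymm h'')
    refine key x hxγ _ (covering_mono (Set.insert_subset hx (Finset.coe_subset.2 hsub))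
      (columnWord_mem_covering δ))
  · rw [mul_assoc, mul_assoc, columnWord_mul_stylicIdempotent_eq_zero hsub, mul_zero, mul_zero]

/-! ### The quiver map -/

theorem rightInsert_eq_of_isFrank {γ : Finset A} {a : A} (h : IsFrank γ a) :
    ∃ b ∈ γ, b < a ∧ (∀ x ∈ γ, x ≤ b ∨ a < x) ∧ rightInsert γ a = insert a (γ.erase b) := by
  obtain ⟨⟨x, hx, hxa⟩, ha⟩ := h
  have hne : (γ.filter (· ≤ a)).Nonempty := ⟨x, Finset.mem_filter.2 ⟨hx, hxa⟩⟩
  have hm := Finset.mem_filter.1 (Finset.max'_mem _ hne)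
  refine ⟨_, hm.1, lt_of_le_of_ne hm.2 fun e => ha (e ▸ hm.1), fun z hz => ?_, ?_⟩
  · rcases le_or_gt z a with h | h
    exacts [Or.inl (Finset.le_max' _ _ (Finset.mem_filter.2 ⟨hz, h⟩)), Or.inr h]
  · rw [rightInsert, dif_pos hne]

section QuiverMap

variable [Fintype A]

theorem quiverMap_ofPath (p : QPath (StylicQuiver A)) :
    quiverMap A (PathAlgebra.ofPath p) = pathImage p.path :=
  PathAlgebra.extend_ofPath _ p

theorem stylicIdempotent_vertex_mul_self (γ : StylicQuiver A) :
    stylicIdempotent (A := A) γ * stylicIdempotent (A := A) γ = stylicIdempotent (A := A) γ :=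
  (stylicIdempotent_mul _ _).trans (if_pos rfl)

theorem stylicIdempotent_vertex_mul_of_ne {γ δ : StylicQuiver A} (h : γ ≠ δ) :
    stylicIdempotent (A := A) γ * stylicIdempotent (A := A) δ = 0 :=
  (stylicIdempotent_mul _ _).trans (if_neg h)

theorem pathImage_mul_stylicIdempotent {γ δ : StylicQuiver A} (p : Quiver.Path γ δ) :
    pathImage p * stylicIdempotent (A := A) δ = pathImage p := by
  cases p with
  | nil => exact stylicIdempotent_vertex_mul_self _
  | cons p c => rw [pathImage, mul_assoc, stylicIdempotent_vertex_mul_self]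

theorem stylicIdempotent_mul_pathImage {γ δ : StylicQuiver A} (p : Quiver.Path γ δ) :
    stylicIdempotent (A := A) γ * pathImage p = pathImage p := by
  induction p with
  | nil => exact stylicIdempotent_vertex_mul_self _
  | cons p c ih => rw [pathImage, ← mul_assoc, ← mul_assoc, ih]

theorem pathImage_comp {γ δ ε : StylicQuiver A} (p : Quiver.Path γ δ) (q : Quiver.Path δ ε) :
    pathImage (p.comp q) = pathImage p * pathImage q := by
  induction q with
  | nil => exact (pathImage_mul_stylicIdempotent p).symm
  | cons q c ih => rw [Quiver.Path.comp_cons, pathImage, pathImage, ih, mul_assoc, mul_assoc,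
      mul_assoc]

theorem quiverMap_ofPath_mul (p q : QPath (StylicQuiver A)) :
    quiverMap A (PathAlgebra.ofPath p * PathAlgebra.ofPath q) =
      quiverMap A (PathAlgebra.ofPath p) * quiverMap A (PathAlgebra.ofPath q) := by
  rw [quiverMap_ofPath, quiverMap_ofPath, PathAlgebra.ofPath_mul_ofPath]
  obtain ⟨γ, δ, p⟩ := p
  obtain ⟨δ', ε, q⟩ := q
  by_cases h : δ = δ'
  · subst h
    rw [PathAlgebra.pathMul_pos, quiverMap_ofPath]
    exact pathImage_comp p q
  · rw [PathAlgebra.pathMul_neg h, map_zero]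
    change 0 = pathImage p * pathImage q
    -- The end idempotents are duplicated so that two orthogonal ones meet at the junction.
    rw [← pathImage_mul_stylicIdempotent p, ← stylicIdempotent_mul_pathImage q, mul_assoc,
      ← mul_assoc (stylicIdempotent (A := A) δ), stylicIdempotent_vertex_mul_of_ne h, zero_mul, mul_zero]

theorem quiverMap_mul (x y : PathAlgebra (StylicQuiver A)) :
    quiverMap A (x * y) = quiverMap A x * quiverMap A y := by
  induction x using PathAlgebra.induction_on' with
  | h0 => rw [zero_mul, map_zero, zero_mul]
  | hadd a b ha hb => rw [add_mul, map_add, map_add, add_mul, ha, hb]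
  | hs n p =>
    induction y using PathAlgebra.induction_on' with
    | h0 => rw [mul_zero, map_zero, mul_zero]
    | hadd a b ha hb => rw [mul_add, map_add, map_add, mul_add, ha, hb]
    | hs m q =>
      rw [PathAlgebra.smul_mul', PathAlgebra.mul_smul', map_smul, map_smul, map_smul, map_smul,
        quiverMap_ofPath_mul, smul_mul_assoc, mul_smul_comm]

theorem quiverMap_one : quiverMap A 1 = 1 := by
  rw [PathAlgebra.one_def, map_sum]
  refine Eq.trans ?_ (sum_stylicIdempotent (A := A))
  exact Finset.sum_congr rfl fun γ _ => quiverMap_ofPath _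

/-- The quiver map as a ring homomorphism. -/
def quiverRingHom (A : Type*) [LinearOrder A] [Fintype A] :
    PathAlgebra (StylicQuiver A) →+* StylicAlgebra A where
  toFun := quiverMap A
  map_one' := quiverMap_one
  map_mul' := quiverMap_mul
  map_zero' := map_zero _
  map_add' := map_add _

theorem stylicIdempotent_mem_range (γ : Finset A) :
    stylicIdempotent γ ∈ (quiverRingHom A).range :=
  ⟨PathAlgebra.ofPath ⟨(γ : StylicQuiver A), (γ : StylicQuiver A), Quiver.Path.nil⟩,
    quiverMap_ofPath _⟩

theorem stylicIdempotent_mul_stylicLetter_mul_mem_range (γ δ : Finset A) (a : A) :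
    stylicIdempotent γ * stylicLetter a * stylicIdempotent δ ∈ (quiverRingHom A).range := by
  by_cases ha : a ∈ γ
  · rw [stylicIdempotent_mul_stylicLetter_of_mem ha]
    exact mul_mem (stylicIdempotent_mem_range γ) (stylicIdempotent_mem_range δ)
  by_cases hx : ∃ x ∈ γ, x ≤ a
  · obtain ⟨b, hb, hba, hγ, hr⟩ := rightInsert_eq_of_isFrank ⟨hx, ha⟩
    by_cases hδ : rightInsert γ a = δ
    · let e : Quiver.Hom (V := StylicQuiver A) γ δ := ⟨a, ⟨hx, ha⟩, hδ⟩
      exact ⟨PathAlgebra.ofPath ⟨_, _, Quiver.Path.nil.cons e⟩, quiverMap_ofPath _⟩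
    · rw [stylicIdempotent_mul_stylicLetter_mul_eq_zero hb hba hγ (hr ▸ hδ)]
      exact zero_mem _
  · rw [stylicIdempotent_mul_stylicLetter_of_lt fun x hxγ => not_le.1 fun h => hx ⟨x, hxγ, h⟩,
      zero_mul]
    exact zero_mem _

theorem stylicLetter_mem_range (a : A) : stylicLetter a ∈ (quiverRingHom A).range := by
  have h : stylicLetter a =
      ∑ γ : Finset A, ∑ δ : Finset A, stylicIdempotent γ * stylicLetter a * stylicIdempotent δ := by
    simp_rw [← Finset.mul_sum, ← Finset.sum_mul, sum_stylicIdempotent, one_mul, mul_one]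
  rw [h]
  exact sum_mem fun γ _ => sum_mem fun δ _ =>
    stylicIdempotent_mul_stylicLetter_mul_mem_range γ δ a

theorem quiverRingHom_surjective : Function.Surjective (quiverRingHom A) := by
  intro x
  change x ∈ (quiverRingHom A).range
  induction x using MonoidAlgebra.induction_on with
  | of m =>
    obtain ⟨w, rfl⟩ := (stylicAction A).mrangeRestrict_surjective m
    have := prod_stylicLetter w.toList
    rw [FreeMonoid.ofList_toList] at this
    change MonoidAlgebra.of ℤ (Styl A) (stylicClass A w) ∈ _
    rw [← this]
    refine list_prod_mem fun y hy => ?_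
    obtain ⟨a, -, rfl⟩ := List.mem_map.1 hy
    exact stylicLetter_mem_range a
  | add f g hf hg => exact add_mem hf hg
  | smul n f hf => exact zsmul_mem hf n

end QuiverMap

end

theorem corollary4 (A : Type*) [LinearOrder A] [Fintype A] :
    ∃ φ : PathAlgebra (StylicQuiver A) →ₐ[ℤ] StylicAlgebra A,
      (∀ x, φ x = quiverMap A x) ∧ Function.Surjective φ :=
  ⟨(quiverRingHom A).toIntAlgHom, fun _ => rfl, quiverRingHom_surjective⟩
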